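/- Let $A\in\mathbb R^{n\times n}$ and $B\in\mathbb R^{n\times m}$ be constant real matrices. Consider the differential Lyapunov system $\dot\Sigma(t)=A\Sigma(t)+\Sigma(t)A'+BU(t)'+U(t)B'$, whose state $\Sigma(t)$ is a symmetric $n\times n$ matrix and whose input is $U(t)\in\mathbb R^{n\times m}$ ($'$ denotes transpose). The system is called controllable if, for any two symmetric matrices $\Sigma_0,\Sigma_1$, there are a time $T>0$ and a bounded measurable input $U$ on $[0,T]$ for which the solution (understood as a continuous solution of the integrated equation) with $\Sigma(0)=\Sigma_0$ satisfies $\Sigma(T)=\Sigma_1$. It is called controllable over $[0,T]$ if this holds for all $\Sigma_0,\Sigma_1$ with that given $T$. The pair $(A,B)$ is called controllable if $\operatorname{rank}[B,AB,\dots,A^{n-1}B]=n$. Then the Lyapunov system is controllable if and only if $(A,B)$ is a controllable pair; likewise, for each $T>0$ it is controllable over $[0,T]$ if and only if $(A,B)$ is a controllable pair. Furthermore, if the Lyapunov system is controllable, then for every $T>0$, any two symmetric positive definite matrices $\Sigma_0,\Sigma_T$ and any symmetric positive semidefinite matrix $Q$, there is a smooth ($C^\infty$) input $U(\cdot)$ such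 that the solution of the forced equation $$\dot\Sigma(t)=A\Sigma(t)+\Sigma(t)A'+BU(t)'+U(t)B'+Q$$ on $[0,T]$ satisfies $\Sigma(0)=\Sigma_0$, $\Sigma(T)=\Sigma_T$ and $\Sigma(t)>0$ (positive definite) for all $t\in[0,T]$. -/

import Mathlib

open scoped Matrix ContDiff

noncomputable section

/-- The block matrix `[B, AB, ..., A^(n-1) B]`; its columns are indexed by pairs
(power of `A`, column of `B`). -/
def controllabilityMatrix {n m : ℕ} (A : Matrix (Fin n) (Fin n) ℝ)
    (B : Matrix (Fin n) (Fin m) ℝ) : Matrix (Fin n) (Fin n × Fin m) ℝ :=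
  Matrix.of fun i p => (A ^ (p.1 : ℕ) * B) i p.2

/-- `(A, B)` is a controllable pair: `[B, AB, ..., A^(n-1) B]` has rank `n`. -/
def IsControllablePair {n m : ℕ} (A : Matrix (Fin n) (Fin n) ℝ)
    (B : Matrix (Fin n) (Fin m) ℝ) : Prop :=
  (controllabilityMatrix A B).rank = n

/-- The right-hand side `A S + S A' + B V' + V B' + Q` of the (forced) Lyapunov system at the
state `S` and the input value `V`. -/
def lyapunovField {n m : ℕ} (A : Matrix (Fin n) (Fin n) ℝ) (B : Matrix (Fin n) (Fin m) ℝ)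
    (Q S : Matrix (Fin n) (Fin n) ℝ) (V : Matrix (Fin n) (Fin m) ℝ) :
    Matrix (Fin n) (Fin n) ℝ :=
  A * S + S * Aᵀ + B * Vᵀ + V * Bᵀ + Q

/-- An admissible input on `[0, T]`: measurable and bounded (entrywise). -/
def IsBoundedInput {n m : ℕ} (T : ℝ) (U : ℝ → Matrix (Fin n) (Fin m) ℝ) : Prop :=
  (∀ i j, Measurable fun t => U t i j) ∧
    ∃ M : ℝ, ∀ t ∈ Set.Icc 0 T, ∀ i j, |U t i j| ≤ M

/-- `S` is a (Carathéodory) solution on `[0, T]` of the unforced Lyapunov system with the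
input `U`: it is continuous and satisfies the integrated equation. -/
def IsLyapunovSolution {n m : ℕ} (A : Matrix (Fin n) (Fin n) ℝ)
    (B : Matrix (Fin n) (Fin m) ℝ) (T : ℝ) (U : ℝ → Matrix (Fin n) (Fin m) ℝ)
    (S : ℝ → Matrix (Fin n) (Fin n) ℝ) : Prop :=
  (∀ i j, ContinuousOn (fun t => S t i j) (Set.Icc 0 T)) ∧
    ∀ t ∈ Set.Icc 0 T, ∀ i j,
      S t i j = S 0 i j + ∫ s in (0 : ℝ)..t, lyapunovField A B 0 (S s) (U s) i j

/-- A bounded input steers the Lyapunov system from `S₀` to `S₁` over `[0, T]`. -/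
def LyapunovSteers {n m : ℕ} (A : Matrix (Fin n) (Fin n) ℝ) (B : Matrix (Fin n) (Fin m) ℝ)
    (T : ℝ) (S₀ S₁ : Matrix (Fin n) (Fin n) ℝ) : Prop :=
  ∃ (U : ℝ → Matrix (Fin n) (Fin m) ℝ) (S : ℝ → Matrix (Fin n) (Fin n) ℝ),
    IsBoundedInput T U ∧ IsLyapunovSolution A B T U S ∧ S 0 = S₀ ∧ S T = S₁

/-- The Lyapunov system, whose state space is the space of symmetric matrices, is controllable:
each state can be driven to each state in some finite time. -/
def LyapunovControllable {n m : ℕ} (A : Matrix (Fin n) (Fin n) ℝ)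
    (B : Matrix (Fin n) (Fin m) ℝ) : Prop :=
  ∀ S₀ S₁ : Matrix (Fin n) (Fin n) ℝ, S₀.IsSymm → S₁.IsSymm →
    ∃ T : ℝ, 0 < T ∧ LyapunovSteers A B T S₀ S₁

/-- Controllability over the prescribed interval `[0, T]`. -/
def LyapunovControllableOn {n m : ℕ} (A : Matrix (Fin n) (Fin n) ℝ)
    (B : Matrix (Fin n) (Fin m) ℝ) (T : ℝ) : Prop :=
  ∀ S₀ S₁ : Matrix (Fin n) (Fin n) ℝ, S₀.IsSymm → S₁.IsSymm → LyapunovSteers A B T S₀ S₁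

end

/-!
*Necessity.* If `(A, B)` is not a controllable pair, some nonzero covector `v` annihilates all
`A^k B`. By Cayley–Hamilton the rows `v' A^k` with `k < n` form a matrix `D ≠ 0` with `D B = 0` and
`D A = C D`, so `Y = D Σ D'` obeys `Ẏ = C Y + Y C'` whatever the input is. By Grönwall's inequality
`Y` stays at `0` if it starts there, hence `Σ = 0` cannot be steered to `Σ = 1`
(`isControllablePair_of_steers`).

*Sufficiency.* In the moving frame `Σ = e^{tA} Z e^{tA'}` the drift disappears: with
`b = e^{-tA} B` and `U = e^{tA} u` the equation reads `Ż = b u' + u b' + e^{-tA} Q e^{-tA'}`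
(`hasDerivAt_of_framed`). Let `g(t) = ∫₀ᵗ b b'` be the controllability Gramian and `G = g(T)`. For a
controllable pair `g` is strictly increasing (`gramian_form_strictMono`), so `G` is invertible and
`u = R G⁻¹ b` adds to `Z` the term `R G⁻¹ g + g G⁻¹ R`, which grows from `0` to `2 R`. Any symmetric
end state is therefore reached, with a smooth input, and whatever `Q` is.

*Positivity.* The input `u = c (b / 2 - g G⁻¹ b)` adds to `Z` the term `c (g - g G⁻¹ g)`, the
covariance of a controlled process pinned to `0` at both ends. It vanishes at `0` and `T` and is
positive definite in between (`bridge_form`). At the two ends the curve is positive definite by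
hypothesis, so by compactness of `[0, T]` times the unit sphere a large `c` makes it positive
definite throughout (`exists_add_mul_pos`). No sign condition on `Q` is needed for this.
-/

/-! ### Matrix exponential and controllability Gramian -/

section Flow

lemma contDiff_of_hasDerivAt {F : Type*} [NormedAddCommGroup F] [NormedSpace ℝ F] {f f' : ℝ → F}
    (h : ∀ t, HasDerivAt f (f' t) t) (hf' : ContDiff ℝ ∞ f') : ContDiff ℝ ∞ f := by
  rw [contDiff_infty_iff_deriv]
  exact ⟨fun t => (h t).differentiableAt, by
    rwa [show deriv f = f' from funext fun t => (h t).deriv]⟩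

open scoped Matrix.Norms.Operator

variable {n m : ℕ}

/-- The matrix exponential `e^{tA}`, the fundamental solution of `ẋ = A x`. -/
noncomputable def flow (A : Matrix (Fin n) (Fin n) ℝ) (t : ℝ) : Matrix (Fin n) (Fin n) ℝ :=
  NormedSpace.exp (t • A)

lemma flow_zero (A : Matrix (Fin n) (Fin n) ℝ) : flow A 0 = 1 := by
  simp [flow]

lemma hasDerivAt_flow (A : Matrix (Fin n) (Fin n) ℝ) (t : ℝ) :
    HasDerivAt (flow A) (A * flow A t) t :=
  hasDerivAt_exp_smul_const' A t

lemma hasDerivAt_flow' (A : Matrix (Fin n) (Fin n) ℝ) (t : ℝ) :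
    HasDerivAt (flow A) (flow A t * A) t :=
  hasDerivAt_exp_smul_const A t

lemma flow_transpose (A : Matrix (Fin n) (Fin n) ℝ) (t : ℝ) : (flow A t)ᵀ = flow Aᵀ t := by
  rw [flow, ← Matrix.exp_transpose, Matrix.transpose_smul, flow]

lemma flow_mul_flow_neg (A : Matrix (Fin n) (Fin n) ℝ) (t : ℝ) :
    flow A t * flow A (-t) = 1 := by
  rw [flow, flow, ← Matrix.exp_add_of_commute]
  · simp
  · rw [neg_smul]
    exact (Commute.refl _).neg_right

lemma contDiff_flow (A : Matrix (Fin n) (Fin n) ℝ) : ContDiff ℝ ∞ (flow A) := by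
  have h : ContDiff ℝ ∞ (NormedSpace.exp : Matrix (Fin n) (Fin n) ℝ → _) :=
    contDiff_iff_contDiffAt.2 fun x => (NormedSpace.exp_analytic x).contDiffAt
  exact h.comp (contDiff_id.smul contDiff_const)

/-- The forcing `M` seen in the moving frame `x ↦ e^{-tA} x`, namely `e^{-tA} M e^{-tA'}`. -/
noncomputable def framed (A M : Matrix (Fin n) (Fin n) ℝ) (t : ℝ) : Matrix (Fin n) (Fin n) ℝ :=
  flow A (-t) * M * (flow A (-t))ᵀ

lemma contDiff_framed (A M : Matrix (Fin n) (Fin n) ℝ) : ContDiff ℝ ∞ (framed A M) := by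
  have h1 : ContDiff ℝ ∞ fun t => flow A (-t) := (contDiff_flow A).comp contDiff_neg
  have h2 : ContDiff ℝ ∞ fun t => (flow A (-t))ᵀ := by
    simp only [flow_transpose]
    exact (contDiff_flow Aᵀ).comp contDiff_neg
  exact (h1.mul contDiff_const).mul h2

lemma framed_isSymm {A M : Matrix (Fin n) (Fin n) ℝ} (hM : M.IsSymm) (t : ℝ) :
    (framed A M t).IsSymm := by
  simp [framed, Matrix.IsSymm, Matrix.transpose_mul, hM.eq, Matrix.mul_assoc]

/-- The Gramian `∫₀ᵗ e^{-sA} M e^{-sA'} ds`. For `M = B B'` it is the controllability Gramian. -/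
noncomputable def gramian (A M : Matrix (Fin n) (Fin n) ℝ) (t : ℝ) : Matrix (Fin n) (Fin n) ℝ :=
  ∫ s in (0 : ℝ)..t, framed A M s

lemma gramian_zero (A M : Matrix (Fin n) (Fin n) ℝ) : gramian A M 0 = 0 :=
  intervalIntegral.integral_same

lemma hasDerivAt_gramian (A M : Matrix (Fin n) (Fin n) ℝ) (t : ℝ) :
    HasDerivAt (gramian A M) (framed A M t) t :=
  (contDiff_framed A M).continuous.integral_hasStrictDerivAt 0 t |>.hasDerivAt

lemma contDiff_gramian (A M : Matrix (Fin n) (Fin n) ℝ) : ContDiff ℝ ∞ (gramian A M) :=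
  contDiff_of_hasDerivAt (hasDerivAt_gramian A M) (contDiff_framed A M)

/-- Passing to an entry of a matrix, as a continuous linear map. -/
noncomputable def entryCLM {k l : ℕ} (i : Fin k) (j : Fin l) : Matrix (Fin k) (Fin l) ℝ →L[ℝ] ℝ :=
  (Matrix.entryLinearMap ℝ ℝ i j).toContinuousLinearMap

lemma HasDerivAt.matrix_entry {k l : ℕ} {X : ℝ → Matrix (Fin k) (Fin l) ℝ}
    {X' : Matrix (Fin k) (Fin l) ℝ} {t : ℝ} (h : HasDerivAt X X' t) (i : Fin k) (j : Fin l) :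
    HasDerivAt (fun s => X s i j) (X' i j) t :=
  (entryCLM i j).hasFDerivAt.comp_hasDerivAt t h

lemma ContDiff.matrix_entry {k l : ℕ} {X : ℝ → Matrix (Fin k) (Fin l) ℝ}
    (h : ContDiff ℝ ∞ X) (i : Fin k) (j : Fin l) : ContDiff ℝ ∞ fun s => X s i j :=
  (entryCLM i j).contDiff.comp h

lemma gramian_isSymm {A M : Matrix (Fin n) (Fin n) ℝ} (hM : M.IsSymm) (t : ℝ) :
    (gramian A M t).IsSymm := by
  have key : ∀ i j, gramian A M t i j = ∫ s in (0 : ℝ)..t, framed A M s i j := fun i j =>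
    ((entryCLM i j).intervalIntegral_comp_comm
      ((contDiff_framed A M).continuous.intervalIntegrable 0 t)).symm
  refine Matrix.IsSymm.ext fun i j => ?_
  simp only [key, (framed_isSymm hM _).apply i j]

/-- The quadratic form of the Gramian of `B B'` at `v` grows at the rate `|B' e^{-tA'} v|²`. -/
lemma hasDerivAt_gramian_form (A : Matrix (Fin n) (Fin n) ℝ) (B : Matrix (Fin n) (Fin m) ℝ)
    (v : Fin n → ℝ) (t : ℝ) :
    HasDerivAt (fun s => v ⬝ᵥ (gramian A (B * Bᵀ) s *ᵥ v))
      ((v ᵥ* (flow A (-t) * B)) ⬝ᵥ (v ᵥ* (flow A (-t) * B))) t := by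
  have h : HasDerivAt (fun s => v ⬝ᵥ (gramian A (B * Bᵀ) s *ᵥ v))
      (v ⬝ᵥ (framed A (B * Bᵀ) t *ᵥ v)) t := by
    simp only [dotProduct, Matrix.mulVec]
    exact HasDerivAt.fun_sum fun i _ => (HasDerivAt.fun_sum fun j _ =>
      ((hasDerivAt_gramian A (B * Bᵀ) t).matrix_entry i j).mul_const (v j)).const_mul (v i)
  convert h using 1
  have e : framed A (B * Bᵀ) t = (flow A (-t) * B) * (flow A (-t) * B)ᵀ := by
    simp [framed, Matrix.mul_assoc, Matrix.transpose_mul]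
  rw [e, ← Matrix.mulVec_mulVec, Matrix.dotProduct_mulVec, Matrix.mulVec_transpose]

/-- For a pair `(A, B)` with no nonzero covector annihilating all `A^k B`, the controllability
Gramian is strictly increasing: were its form at `v` constant on an interval, then
`v' e^{-tA} B` and all its derivatives would vanish there. -/
lemma gramian_form_strictMono {A : Matrix (Fin n) (Fin n) ℝ} {B : Matrix (Fin n) (Fin m) ℝ}
    (hAB : ∀ v : Fin n → ℝ, (∀ k : ℕ, v ᵥ* (A ^ k * B) = 0) → v = 0)
    {v : Fin n → ℝ} (hv : v ≠ 0) : StrictMono fun s => v ⬝ᵥ (gramian A (B * Bᵀ) s *ᵥ v) := by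
  have hd := hasDerivAt_gramian_form A B v
  have hmono : Monotone fun s => v ⬝ᵥ (gramian A (B * Bᵀ) s *ᵥ v) :=
    monotone_of_hasDerivAt_nonneg hd fun t => dotProduct_self_star_nonneg _
  intro a b hab
  refine lt_of_le_of_ne (hmono hab.le) fun heq => hv ?_
  have hvan : ∀ k : ℕ, ∀ t ∈ Set.Ioo a b, v ᵥ* (flow A (-t) * (A ^ k * B)) = 0 := by
    intro k
    induction k with
    | zero =>
      intro t ht
      have hloc : (fun s => v ⬝ᵥ (gramian A (B * Bᵀ) s *ᵥ v)) =ᶠ[nhds t]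
          fun _ => v ⬝ᵥ (gramian A (B * Bᵀ) a *ᵥ v) := by
        filter_upwards [isOpen_Ioo.mem_nhds ht] with s hs
        exact le_antisymm ((hmono hs.2.le).trans_eq heq.symm) (hmono hs.1.le)
      have h0 := (hd t).unique ((hasDerivAt_const t _).congr_of_eventuallyEq hloc)
      simpa using dotProduct_self_eq_zero.1 h0
    | succ k ih =>
      intro t ht
      have hder : HasDerivAt (fun s => flow A (-s)) (-(flow A (-t) * A)) t := by
        have h := (hasDerivAt_flow' A (-t)).scomp t (hasDerivAt_neg t)
        rw [neg_one_smul] at h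
        exact h
      ext j
      have hj : HasDerivAt (fun s => (v ᵥ* (flow A (-s) * (A ^ k * B))) j)
          ((v ᵥ* (-(flow A (-t) * A) * (A ^ k * B))) j) t := by
        simp only [Matrix.vecMul, dotProduct, Matrix.mul_apply]
        exact HasDerivAt.fun_sum fun i _ => (HasDerivAt.fun_sum fun l _ =>
          (hder.matrix_entry i l).mul_const _).const_mul (v i)
      have hloc : (fun s => (v ᵥ* (flow A (-s) * (A ^ k * B))) j) =ᶠ[nhds t] fun _ => 0 := by
        filter_upwards [isOpen_Ioo.mem_nhds ht] with s hs
        rw [ih s hs, Pi.zero_apply]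
      have h0 := hj.unique ((hasDerivAt_const t 0).congr_of_eventuallyEq hloc)
      rw [Matrix.neg_mul, Matrix.vecMul_neg, Pi.neg_apply, neg_eq_zero] at h0
      rw [pow_succ', Pi.zero_apply, ← h0]
      simp only [Matrix.mul_assoc]
  have hmid : (a + b) / 2 ∈ Set.Ioo a b := ⟨by linarith, by linarith⟩
  have hw : v ᵥ* flow A (-((a + b) / 2)) = 0 :=
    hAB _ fun k => by rw [Matrix.vecMul_vecMul]; exact hvan k _ hmid
  have hinv := flow_mul_flow_neg A (-((a + b) / 2))
  rw [← Matrix.vecMul_one v, ← hinv, ← Matrix.vecMul_vecMul, hw, Matrix.zero_vecMul]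

end Flow

/-! ### Necessity of the rank condition -/

section Necessity

variable {n m : ℕ}

lemma isControllablePair_iff {A : Matrix (Fin n) (Fin n) ℝ} {B : Matrix (Fin n) (Fin m) ℝ} :
    IsControllablePair A B ↔
      ∀ v : Fin n → ℝ, (∀ k < n, v ᵥ* (A ^ k * B) = 0) → v = 0 := by
  have hcol : ∀ v : Fin n → ℝ,
      v ᵥ* controllabilityMatrix A B = 0 ↔ ∀ k < n, v ᵥ* (A ^ k * B) = 0 := fun v =>
    ⟨fun h k hk => funext fun j => congrFun h (⟨k, hk⟩, j),
      fun h => funext fun p => congrFun (h p.1 p.1.2) p.2⟩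
  have hrank : IsControllablePair A B ↔ LinearIndependent ℝ (controllabilityMatrix A B).row := by
    rw [linearIndependent_iff_card_eq_finrank_span, Set.finrank, ← Matrix.rank_eq_finrank_span_row,
      Fintype.card_fin, IsControllablePair, eq_comm]
  rw [hrank, ← Matrix.vecMul_injective_iff]
  constructor
  · intro h v hv
    exact h (((hcol v).2 hv).trans (Matrix.zero_vecMul _).symm)
  · intro h v w hvw
    refine sub_eq_zero.1 (h _ ((hcol _).1 ?_))
    rw [Matrix.sub_vecMul]
    exact sub_eq_zero.2 hvw

/-- By the Cayley–Hamilton theorem every power of `A` is a combination of the first `n`. -/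
lemma exists_pow_eq_sum (A : Matrix (Fin n) (Fin n) ℝ) (k : ℕ) :
    ∃ c : Fin n → ℝ, A ^ k = ∑ j, c j • A ^ (j : ℕ) := by
  rcases n.eq_zero_or_pos with rfl | hn
  · exact ⟨0, Subsingleton.elim _ _⟩
  have hdeg : (Polynomial.X ^ k %ₘ A.charpoly).natDegree < n := by
    have h := Polynomial.natDegree_modByMonic_lt (Polynomial.X ^ k) A.charpoly_monic
      (fun h => by
        have := A.charpoly_natDegree_eq_dim
        rw [h, Polynomial.natDegree_one, Fintype.card_fin] at this
        omega)
    rwa [A.charpoly_natDegree_eq_dim, Fintype.card_fin] at h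
  refine ⟨fun j => (Polynomial.X ^ k %ₘ A.charpoly).coeff j, ?_⟩
  rw [Matrix.pow_eq_aeval_mod_charpoly, Polynomial.aeval_eq_sum_range' hdeg, Finset.sum_range]

/-- If `(A, B)` is not controllable, the rows `v' A^j` of a covector `v` annihilating
`[B, AB, …]` form a nonzero matrix `D` with `D B = 0` whose row space is invariant under `A`. -/
lemma exists_annihilator {A : Matrix (Fin n) (Fin n) ℝ} {B : Matrix (Fin n) (Fin m) ℝ}
    (hAB : ¬ IsControllablePair A B) :
    ∃ D C : Matrix (Fin n) (Fin n) ℝ, D ≠ 0 ∧ D * B = 0 ∧ D * A = C * D := by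
  rw [isControllablePair_iff] at hAB
  push Not at hAB
  obtain ⟨v, hv, hv0⟩ := hAB
  have hn : 0 < n := by
    rcases n.eq_zero_or_pos with rfl | hn
    · exact absurd (Subsingleton.elim v 0) hv0
    · exact hn
  choose c hc using fun k => exists_pow_eq_sum A k
  refine ⟨Matrix.of fun k => v ᵥ* A ^ (k : ℕ), Matrix.of fun k => c (k + 1), ?_, ?_, ?_⟩
  · intro h
    apply hv0
    have h0 : v ᵥ* A ^ 0 = 0 := congrFun h ⟨0, hn⟩
    simpa using h0
  · ext k j
    have := congrFun (hv k k.2) j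
    rw [← Matrix.vecMul_vecMul] at this
    exact this
  · ext k j
    have h1 : (v ᵥ* A ^ (k : ℕ)) ᵥ* A = ∑ l, c (k + 1) l • (v ᵥ* A ^ (l : ℕ)) := by
      rw [Matrix.vecMul_vecMul, ← pow_succ, hc (k + 1), Matrix.vecMul_sum]
      simp only [Matrix.vecMul_smul]
    have := congrFun h1 j
    rw [Finset.sum_apply] at this
    exact this

lemma IntervalIntegrable.fun_sum {ι : Type*} (s : Finset ι) {f : ι → ℝ → ℝ} {a b : ℝ}
    (h : ∀ i ∈ s, IntervalIntegrable (f i) MeasureTheory.volume a b) :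
    IntervalIntegrable (fun x => ∑ i ∈ s, f i x) MeasureTheory.volume a b := by
  simpa [← Finset.sum_fn] using IntervalIntegrable.sum s h

open MeasureTheory in
lemma intervalIntegrable_lyapunovField {A : Matrix (Fin n) (Fin n) ℝ}
    {B : Matrix (Fin n) (Fin m) ℝ} {T : ℝ} {U : ℝ → Matrix (Fin n) (Fin m) ℝ}
    {S : ℝ → Matrix (Fin n) (Fin n) ℝ} (hU : IsBoundedInput T U)
    (hS : ∀ i j, ContinuousOn (fun t => S t i j) (Set.Icc 0 T)) {t : ℝ} (ht : t ∈ Set.Icc 0 T)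
    (i j : Fin n) :
    IntervalIntegrable (fun s => lyapunovField A B 0 (S s) (U s) i j) volume 0 t := by
  have hsub : Set.uIcc 0 t ⊆ Set.Icc 0 T := by
    rw [Set.uIcc_of_le ht.1]
    exact Set.Icc_subset_Icc_right ht.2
  have hSi : ∀ k l, IntervalIntegrable (fun s => S s k l) volume 0 t := fun k l =>
    ((hS k l).mono hsub).intervalIntegrable
  obtain ⟨hm, M, hM⟩ := hU
  have hUi : ∀ k l, IntervalIntegrable (fun s => U s k l) volume 0 t := fun k l => by
    rw [intervalIntegrable_iff]
    refine Measure.integrableOn_of_bounded (M := M) (by simp) (hm k l).aestronglyMeasurable ?_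
    refine (ae_restrict_iff' measurableSet_uIoc).2 (Filter.Eventually.of_forall fun s hs => ?_)
    exact hM s (hsub (Set.uIoc_subset_uIcc hs)) k l
  simp only [lyapunovField, Matrix.add_apply, Matrix.mul_apply, Matrix.transpose_apply,
    Matrix.zero_apply, add_zero]
  have h1 : IntervalIntegrable (fun s => ∑ k, A i k * S s k j) volume 0 t :=
    .fun_sum _ fun k _ => (hSi k j).const_mul _
  have h2 : IntervalIntegrable (fun s => ∑ k, S s i k * A j k) volume 0 t :=
    .fun_sum _ fun k _ => (hSi i k).mul_const _
  have h3 : IntervalIntegrable (fun s => ∑ k, B i k * U s j k) volume 0 t :=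
    .fun_sum _ fun k _ => (hUi j k).const_mul _
  have h4 : IntervalIntegrable (fun s => ∑ k, U s i k * B j k) volume 0 t :=
    .fun_sum _ fun k _ => (hUi i k).mul_const _
  exact ((h1.add h2).add h3).add h4

open scoped Matrix.Norms.Operator

/-- Uniqueness for the homogeneous linear equation `Ẏ = C Y + Y C'` in integrated form. -/
lemma eq_zero_of_integral_eq {C : Matrix (Fin n) (Fin n) ℝ} {T : ℝ} (hT : 0 ≤ T)
    {Y : ℝ → Matrix (Fin n) (Fin n) ℝ} (hY : ContinuousOn Y (Set.Icc 0 T))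
    (hint : ∀ t ∈ Set.Icc 0 T, Y t = ∫ s in (0 : ℝ)..t, (C * Y s + Y s * Cᵀ)) :
    ∀ t ∈ Set.Icc 0 T, Y t = 0 := by
  set Z : ℝ → Matrix (Fin n) (Fin n) ℝ := Set.IccExtend hT ((Set.Icc 0 T).domRestrict Y) with hZ
  have hZc : Continuous Z := hY.domRestrict.Icc_extend'
  have hZY : ∀ t ∈ Set.Icc 0 T, Z t = Y t := fun t ht => by
    rw [hZ, Set.IccExtend_of_mem hT _ ht]; rfl
  set F : ℝ → Matrix (Fin n) (Fin n) ℝ := fun t => ∫ s in (0 : ℝ)..t, (C * Z s + Z s * Cᵀ)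
  have hF : ∀ t, HasDerivAt F (C * Z t + Z t * Cᵀ) t := fun t =>
    (((continuous_const.mul hZc).add (hZc.mul continuous_const)).integral_hasStrictDerivAt
      0 t).hasDerivAt
  have hFY : ∀ t ∈ Set.Icc 0 T, F t = Y t := fun t ht => by
    rw [hint t ht]
    refine intervalIntegral.integral_congr fun s hs => ?_
    rw [Set.uIcc_of_le ht.1] at hs
    simp only [hZY s ⟨hs.1, hs.2.trans ht.2⟩]
  intro t ht
  have hb := norm_le_gronwallBound_of_norm_deriv_right_le (f := F)
    (f' := fun t => C * Z t + Z t * Cᵀ) (δ := 0) (K := ‖C‖ + ‖Cᵀ‖) (ε := 0) (a := 0) (b := T)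
    (fun s _ => (hF s).continuousAt.continuousWithinAt) (fun s _ => (hF s).hasDerivWithinAt)
    (by simp [F])
    (fun s hs => by
      have hs' : s ∈ Set.Icc 0 T := ⟨hs.1, hs.2.le⟩
      rw [hZY s hs', hFY s hs', add_zero, add_mul]
      refine (norm_add_le _ _).trans (add_le_add (norm_mul_le _ _) ?_)
      rw [mul_comm]
      exact norm_mul_le _ _) t ht
  rw [gronwallBound_ε0_δ0, hFY t ht] at hb
  exact norm_le_zero_iff.1 hb

/-- Steering `0` to the identity already forces controllability of the pair: otherwise
`D S(t) D'`, which the input does not affect, would stay at `0`. -/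
lemma isControllablePair_of_steers {A : Matrix (Fin n) (Fin n) ℝ} {B : Matrix (Fin n) (Fin m) ℝ}
    {T : ℝ} (hT : 0 < T) (h : LyapunovSteers A B T 0 1) : IsControllablePair A B := by
  by_contra hAB
  obtain ⟨D, C, hD0, hDB, hDA⟩ := exists_annihilator hAB
  obtain ⟨U, S, hU, ⟨hS, hSint⟩, hS0, hS1⟩ := h
  have hSc : ContinuousOn S (Set.Icc 0 T) := continuousOn_pi.2 fun i => continuousOn_pi.2 (hS i)
  have hBD : Bᵀ * Dᵀ = 0 := by rw [← Matrix.transpose_mul, hDB, Matrix.transpose_zero]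
  have hAD : Aᵀ * Dᵀ = Dᵀ * Cᵀ := by rw [← Matrix.transpose_mul, hDA, Matrix.transpose_mul]
  have hfield : ∀ s, D * lyapunovField A B 0 (S s) (U s) * Dᵀ =
      C * (D * S s * Dᵀ) + D * S s * Dᵀ * Cᵀ := fun s => by
    simp only [lyapunovField, Matrix.mul_add, Matrix.add_mul, add_zero]
    have e1 : D * (A * S s) * Dᵀ = C * (D * S s * Dᵀ) := by
      rw [← Matrix.mul_assoc D, hDA]; simp only [Matrix.mul_assoc]
    have e2 : D * (S s * Aᵀ) * Dᵀ = D * S s * Dᵀ * Cᵀ := by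
      simp only [Matrix.mul_assoc, hAD]
    have e3 : D * (B * (U s)ᵀ) * Dᵀ = 0 := by
      rw [← Matrix.mul_assoc D, hDB]; simp
    have e4 : D * (U s * Bᵀ) * Dᵀ = 0 := by
      simp only [Matrix.mul_assoc, hBD, Matrix.mul_zero]
    rw [e1, e2, e3, e4, add_zero, add_zero]
  have hYc : ContinuousOn (fun t => D * S t * Dᵀ) (Set.Icc 0 T) :=
    (continuousOn_const.mul hSc).mul continuousOn_const
  have hzero := eq_zero_of_integral_eq (C := C) hT.le hYc (fun t ht => by
    have hfi := fun i j => intervalIntegrable_lyapunovField (A := A) (B := B) hU hS ht i j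
    have hci : ContinuousOn (fun s => C * (D * S s * Dᵀ) + D * S s * Dᵀ * Cᵀ) (Set.uIcc 0 t) := by
      refine ((continuousOn_const.mul hYc).add (hYc.mul continuousOn_const)).mono ?_
      rw [Set.uIcc_of_le ht.1]
      exact Set.Icc_subset_Icc_right ht.2
    ext i j
    refine Eq.trans ?_ ((entryCLM i j).intervalIntegral_comp_comm hci.intervalIntegrable)
    change _ = ∫ s in (0 : ℝ)..t, (C * (D * S s * Dᵀ) + D * S s * Dᵀ * Cᵀ) i j
    simp only [← hfield, Matrix.mul_apply, Matrix.transpose_apply, Finset.sum_mul]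
    rw [intervalIntegral.integral_finsetSum fun l _ => .fun_sum _ fun k _ =>
      ((hfi k l).const_mul _).mul_const _]
    refine Finset.sum_congr rfl fun l _ => ?_
    rw [intervalIntegral.integral_finsetSum fun k _ => ((hfi k l).const_mul _).mul_const _]
    refine Finset.sum_congr rfl fun k _ => ?_
    rw [intervalIntegral.integral_mul_const, intervalIntegral.integral_const_mul, hSint t ht k l,
      hS0, Matrix.zero_apply, zero_add])
  have hT1 := hzero T ⟨hT.le, le_rfl⟩
  simp only [hS1, Matrix.mul_one] at hT1
  rw [← Matrix.conjTranspose_eq_transpose_of_trivial, Matrix.self_mul_conjTranspose_eq_zero] at hT1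
  exact hD0 hT1

end Necessity

/-! ### Steering in the moving frame -/

section Steering

open scoped Matrix.Norms.Operator

variable {n m : ℕ}

lemma flow_mul_framed_mul (A M : Matrix (Fin n) (Fin n) ℝ) (t : ℝ) :
    flow A t * framed A M t * (flow A t)ᵀ = M := by
  have h := congrArg Matrix.transpose (flow_mul_flow_neg A t)
  rw [Matrix.transpose_mul, Matrix.transpose_one] at h
  calc flow A t * framed A M t * (flow A t)ᵀ
      = (flow A t * flow A (-t)) * M * ((flow A (-t))ᵀ * (flow A t)ᵀ) := by
        simp only [framed, Matrix.mul_assoc]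
    _ = M := by rw [flow_mul_flow_neg, h, Matrix.one_mul, Matrix.mul_one]

/-- Change of frame: if `Z` solves the system without drift whose input acts through
`e^{-tA} B`, then `e^{tA} Z e^{tA'}` solves the Lyapunov system. -/
lemma hasDerivAt_of_framed {A : Matrix (Fin n) (Fin n) ℝ} {B : Matrix (Fin n) (Fin m) ℝ}
    {Q : Matrix (Fin n) (Fin n) ℝ} {Z K : ℝ → Matrix (Fin n) (Fin n) ℝ} {t : ℝ}
    (hZ : HasDerivAt Z
      (framed A Q t + K t * framed A (B * Bᵀ) t + framed A (B * Bᵀ) t * (K t)ᵀ) t) :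
    HasDerivAt (fun s => flow A s * Z s * (flow A s)ᵀ)
      (lyapunovField A B Q (flow A t * Z t * (flow A t)ᵀ)
        (flow A t * K t * flow A (-t) * B)) t := by
  have hE := hasDerivAt_flow A t
  have hE' : HasDerivAt (fun s => (flow A s)ᵀ) ((flow A t)ᵀ * Aᵀ) t := by
    simp only [flow_transpose]
    exact hasDerivAt_flow' Aᵀ t
  have h := (hE.mul hZ).mul hE'
  have hQ := flow_mul_framed_mul A Q t
  have hE1 := congrArg Matrix.transpose (flow_mul_flow_neg A t)
  rw [Matrix.transpose_mul, Matrix.transpose_one] at hE1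
  have hl : flow A t * (K t * framed A (B * Bᵀ) t) * (flow A t)ᵀ
      = flow A t * K t * flow A (-t) * B * Bᵀ := by
    simp only [framed, Matrix.mul_assoc, hE1, Matrix.mul_one]
  have hr : flow A t * (framed A (B * Bᵀ) t * (K t)ᵀ) * (flow A t)ᵀ
      = B * (flow A t * K t * flow A (-t) * B)ᵀ := by
    have := congrArg Matrix.transpose hl
    simpa [Matrix.transpose_mul, Matrix.mul_assoc, framed] using this
  refine h.congr_deriv ?_
  calc (A * flow A t * Z t + flow A t * (framed A Q t + K t * framed A (B * Bᵀ) t +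
          framed A (B * Bᵀ) t * (K t)ᵀ)) * (flow A t)ᵀ + flow A t * Z t * ((flow A t)ᵀ * Aᵀ)
      = A * (flow A t * Z t * (flow A t)ᵀ) + flow A t * Z t * (flow A t)ᵀ * Aᵀ +
          flow A t * (framed A (B * Bᵀ) t * (K t)ᵀ) * (flow A t)ᵀ +
          flow A t * (K t * framed A (B * Bᵀ) t) * (flow A t)ᵀ +
          flow A t * framed A Q t * (flow A t)ᵀ := by noncomm_ring
    _ = _ := by rw [hl, hr, hQ]; rfl

/-- The quadratic form of `g - g G⁻¹ g`, the covariance of a bridge pinned at both ends, as a sum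
of two squares. -/
lemma bridge_form {g G : Matrix (Fin n) (Fin n) ℝ} (hg : g.IsSymm) (hG : IsUnit G.det)
     (v : Fin n → ℝ) :
    v ⬝ᵥ ((g - g * G⁻¹ * g) *ᵥ v) =
      (v - G⁻¹ *ᵥ (g *ᵥ v)) ⬝ᵥ (g *ᵥ (v - G⁻¹ *ᵥ (g *ᵥ v))) +
        (G⁻¹ *ᵥ (g *ᵥ v)) ⬝ᵥ ((G - g) *ᵥ (G⁻¹ *ᵥ (g *ᵥ v))) := by
  set w := G⁻¹ *ᵥ (g *ᵥ v) with hw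
  have hGw : G *ᵥ w = g *ᵥ v := by
    rw [hw, Matrix.mulVec_mulVec, Matrix.mul_nonsing_inv _ hG, Matrix.one_mulVec]
  have hsym : ∀ x y : Fin n → ℝ, x ⬝ᵥ (g *ᵥ y) = y ⬝ᵥ (g *ᵥ x) := fun x y => by
    rw [Matrix.dotProduct_mulVec, ← Matrix.mulVec_transpose, hg.eq, dotProduct_comm]
  have h1 : (g - g * G⁻¹ * g) *ᵥ v = g *ᵥ v - g *ᵥ w := by
    rw [Matrix.sub_mulVec, hw, Matrix.mulVec_mulVec, Matrix.mulVec_mulVec]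
  rw [h1]
  simp only [Matrix.mulVec_sub, Matrix.sub_mulVec, dotProduct_sub, sub_dotProduct, hGw,
    hsym w v]
  ring

/-- The path in the moving frame: for symmetric `R` and `G = g T` it joins `S₀` to
`S₀ + h T + 2 R`, where `h` accumulates the forcing, and it carries `c` times the bridge
`g - g G⁻¹ g`, which vanishes at both ends. -/
noncomputable def framedPath (g h : ℝ → Matrix (Fin n) (Fin n) ℝ)
    (G S₀ R : Matrix (Fin n) (Fin n) ℝ) (c : ℝ) (t : ℝ) : Matrix (Fin n) (Fin n) ℝ :=
  S₀ + h t + (R * G⁻¹ * g t + g t * (R * G⁻¹)ᵀ) + c • (g t - g t * G⁻¹ * g t)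

/-- The gain `K` for which the input `e^{tA} K e^{-tA} B` produces `framedPath`. -/
noncomputable def framedGain (g : ℝ → Matrix (Fin n) (Fin n) ℝ)
    (G R : Matrix (Fin n) (Fin n) ℝ) (c : ℝ) (t : ℝ) : Matrix (Fin n) (Fin n) ℝ :=
  R * G⁻¹ + c • ((1 / 2 : ℝ) • (1 : Matrix (Fin n) (Fin n) ℝ) - g t * G⁻¹)

lemma hasDerivAt_framedPath {g h : ℝ → Matrix (Fin n) (Fin n) ℝ} {t : ℝ}
    {p q : Matrix (Fin n) (Fin n) ℝ} (hg : HasDerivAt g p t) (hh : HasDerivAt h q t)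
    {G : Matrix (Fin n) (Fin n) ℝ} (hG : G.IsSymm) (hgs : (g t).IsSymm)
    (S₀ R : Matrix (Fin n) (Fin n) ℝ) (c : ℝ) :
    HasDerivAt (framedPath g h G S₀ R c)
      (q + framedGain g G R c t * p + p * (framedGain g G R c t)ᵀ) t := by
  have h1 := hg.const_mul (R * G⁻¹)
  have h2 := hg.mul_const (R * G⁻¹)ᵀ
  have h3 := hg.sub ((hg.mul_const G⁻¹).mul hg)
  have H := ((hh.const_add S₀).add (h1.add h2)).add (h3.const_smul c)
  refine H.congr_deriv ?_
  have hGi : (G⁻¹)ᵀ = G⁻¹ := by rw [Matrix.transpose_nonsing_inv, hG.eq]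
  simp only [framedGain, Matrix.transpose_add, Matrix.transpose_smul, Matrix.transpose_sub,
    Matrix.transpose_one, Matrix.transpose_mul, hGi, hgs.eq, Matrix.add_mul, Matrix.mul_add,
    Matrix.smul_mul, Matrix.mul_smul, Matrix.sub_mul, Matrix.mul_sub, Matrix.one_mul,
    Matrix.mul_one, smul_sub, smul_add, Matrix.mul_assoc]
  module

lemma contDiff_framedGain {g : ℝ → Matrix (Fin n) (Fin n) ℝ} (hg : ContDiff ℝ ∞ g)
    (G R : Matrix (Fin n) (Fin n) ℝ) (c : ℝ) : ContDiff ℝ ∞ (framedGain g G R c) := by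
  have h1 : ContDiff ℝ ∞ fun t => g t * G⁻¹ := hg.mul contDiff_const
  have h2 : ContDiff ℝ ∞ fun t => (1 / 2 : ℝ) • (1 : Matrix (Fin n) (Fin n) ℝ) - g t * G⁻¹ :=
    contDiff_const.sub h1
  exact contDiff_const.add (h2.const_smul c)

/-- On a compact set, a function that is positive where `g ≥ 0` vanishes becomes positive
everywhere once a large multiple of `g` is added. -/
lemma exists_add_mul_pos {X : Type*} [TopologicalSpace X] {s : Set X} (hs : IsCompact s)
    {f g : X → ℝ} (hf : Continuous f) (hg : Continuous g) (hg0 : ∀ x ∈ s, 0 ≤ g x)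
    (hfg : ∀ x ∈ s, g x = 0 → 0 < f x) : ∃ c : ℝ, ∀ x ∈ s, 0 < f x + c * g x := by
  -- `max (g x) 0` in place of `g x` makes the cover increase with `N` also outside `s`
  obtain ⟨N, hN⟩ := hs.elim_directed_cover (fun N : ℕ => {x | 0 < f x + N * max (g x) 0})
    (fun N => isOpen_lt continuous_const (by fun_prop))
    (fun x hx => by
      rcases (hg0 x hx).eq_or_lt with h | h
      · exact Set.mem_iUnion.2 ⟨0, by simpa using hfg x hx h.symm⟩
      · obtain ⟨N, hN⟩ := exists_nat_gt (-f x / g x)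
        refine Set.mem_iUnion.2 ⟨N, ?_⟩
        rw [div_lt_iff₀ h] at hN
        simp only [Set.mem_ofPred_eq, max_eq_left h.le]
        linarith)
    (directed_of_isDirected_le fun N M hNM x (hx : 0 < f x + N * max (g x) 0) =>
      show 0 < f x + M * max (g x) 0 from hx.trans_le (by gcongr))
  exact ⟨N, fun x hx => by simpa [max_eq_left (hg0 x hx)] using hN hx⟩

end Steering

/-! ### Steering by a controllable pair -/

section Sufficiency
open scoped Matrix.Norms.Operator

variable {n m : ℕ}

lemma gramian_sub_form_pos {A : Matrix (Fin n) (Fin n) ℝ} {B : Matrix (Fin n) (Fin m) ℝ}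
    (hAB : IsControllablePair A B) {s t : ℝ} (hst : s < t) {v : Fin n → ℝ} (hv : v ≠ 0) :
    0 < v ⬝ᵥ ((gramian A (B * Bᵀ) t - gramian A (B * Bᵀ) s) *ᵥ v) := by
  have h := gramian_form_strictMono (fun w hw => isControllablePair_iff.1 hAB w fun k _ => hw k)
    hv hst
  rw [Matrix.sub_mulVec, dotProduct_sub]
  exact sub_pos.2 h

/-- For a controllable pair and any forcing `Q`, there are curves joining the two given end states
to which any multiple of a bridge, positive definite inside the time interval, may be added. In
the moving frame the curves are `Z + c • C`. -/
lemma exists_steering_family {A : Matrix (Fin n) (Fin n) ℝ} {B : Matrix (Fin n) (Fin m) ℝ}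
    (hAB : IsControllablePair A B) {T : ℝ} (hT : 0 < T) {S₀ S₁ Q : Matrix (Fin n) (Fin n) ℝ}
    (h₀ : S₀.IsSymm) (h₁ : S₁.IsSymm) (hQ : Q.IsSymm) :
    ∃ Z C : ℝ → Matrix (Fin n) (Fin n) ℝ,
      Continuous Z ∧ Continuous C ∧ (∀ t, (Z t).IsSymm) ∧ (∀ t, (C t).IsSymm) ∧
      Z 0 = S₀ ∧ Z T = framed A S₁ T ∧ C 0 = 0 ∧ C T = 0 ∧
      (∀ t ∈ Set.Ioo 0 T, ∀ v : Fin n → ℝ, v ≠ 0 → 0 < v ⬝ᵥ (C t *ᵥ v)) ∧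
      ∀ c : ℝ, ∃ X : ℝ → Matrix (Fin n) (Fin n) ℝ, ContDiff ℝ ∞ X ∧
        ∀ t, HasDerivAt (fun s => flow A s * (Z s + c • C s) * (flow A s)ᵀ)
          (lyapunovField A B Q (flow A t * (Z t + c • C t) * (flow A t)ᵀ) (X t * B)) t := by
  set g := gramian A (B * Bᵀ)
  set h := gramian A Q
  set G := g T with hGdef
  set R := (1 / 2 : ℝ) • (framed A S₁ T - S₀ - h T) with hR
  have hBs : (B * Bᵀ).IsSymm := by simp [Matrix.IsSymm]
  have hgs : ∀ t, (g t).IsSymm := gramian_isSymm hBs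
  have hhs : ∀ t, (h t).IsSymm := gramian_isSymm hQ
  have hRs : R.IsSymm := (((framed_isSymm h₁ T).sub h₀).sub (hhs T)).smul _
  have hgc : ContDiff ℝ ∞ g := contDiff_gramian A _
  have hpos : ∀ s t, s < t → ∀ v : Fin n → ℝ, v ≠ 0 → 0 < v ⬝ᵥ ((g t - g s) *ᵥ v) :=
    fun s t hst v hv => gramian_sub_form_pos hAB hst hv
  have hg0 : g 0 = 0 := gramian_zero A _
  have hh0 : h 0 = 0 := gramian_zero A _
  have hGpd : G.PosDef := .of_dotProduct_mulVec_pos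
    (by rw [Matrix.IsHermitian, Matrix.conjTranspose_eq_transpose_of_trivial, (hgs T).eq])
    fun v hv => by simpa [hg0] using hpos 0 T hT v hv
  have hGu : IsUnit G.det := (Matrix.isUnit_iff_isUnit_det _).1 hGpd.isUnit
  have hGi : (G⁻¹)ᵀ = G⁻¹ := by rw [Matrix.transpose_nonsing_inv, (hgs T).eq]
  have hGl : G⁻¹ * G = 1 := Matrix.nonsing_inv_mul _ hGu
  have hGr : G * G⁻¹ = 1 := Matrix.mul_nonsing_inv _ hGu
  have hCs : ∀ t, (g t - g t * G⁻¹ * g t).IsSymm := fun t => by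
    rw [Matrix.IsSymm, Matrix.transpose_sub, Matrix.transpose_mul, Matrix.transpose_mul, hGi,
      (hgs t).eq, Matrix.mul_assoc]
  have hZs : ∀ t, (framedPath g h G S₀ R 0 t).IsSymm := fun t => by
    rw [framedPath, zero_smul, add_zero]
    refine (h₀.add (hhs t)).add ?_
    have e : g t * (R * G⁻¹)ᵀ = (R * G⁻¹ * g t)ᵀ := by
      rw [Matrix.transpose_mul (R * G⁻¹), (hgs t).eq]
    rw [e]
    exact Matrix.isSymm_add_transpose_self _
  have hder : ∀ c t, HasDerivAt (framedPath g h G S₀ R c) (framed A Q t +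
      framedGain g G R c t * framed A (B * Bᵀ) t +
      framed A (B * Bᵀ) t * (framedGain g G R c t)ᵀ) t := fun c t =>
    hasDerivAt_framedPath (hasDerivAt_gramian A _ t) (hasDerivAt_gramian A Q t) (hgs T) (hgs t)
      S₀ R c
  refine ⟨framedPath g h G S₀ R 0, fun t => g t - g t * G⁻¹ * g t,
    continuous_iff_continuousAt.2 fun t => (hder 0 t).continuousAt,
    hgc.continuous.sub ((hgc.continuous.mul continuous_const).mul hgc.continuous),
    hZs, hCs, ?_, ?_, ?_, ?_, ?_, ?_⟩
  · simp [framedPath, hg0, hh0]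
  · have e : R * G⁻¹ * G + G * (R * G⁻¹)ᵀ = framed A S₁ T - S₀ - h T := by
      rw [Matrix.mul_assoc, hGl, Matrix.transpose_mul, hGi, ← Matrix.mul_assoc, hGr, hRs.eq,
        Matrix.mul_one, Matrix.one_mul, hR]
      module
    rw [framedPath, zero_smul, add_zero, ← hGdef, e]
    abel
  · simp [hg0]
  · change G - G * G⁻¹ * G = 0
    rw [hGr, Matrix.one_mul, sub_self]
  · intro t ht v hv
    rw [bridge_form (hgs t) hGu]
    set w := G⁻¹ *ᵥ (g t *ᵥ v)
    have hnn : ∀ s t, s < t → ∀ u : Fin n → ℝ, 0 ≤ u ⬝ᵥ ((g t - g s) *ᵥ u) := fun s t hst u => by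
      rcases eq_or_ne u 0 with rfl | hu
      · simp
      · exact (hpos s t hst u hu).le
    have hgt : ∀ u, u ⬝ᵥ (g t *ᵥ u) = u ⬝ᵥ ((g t - g 0) *ᵥ u) := fun u => by rw [hg0, sub_zero]
    rw [hgt]
    -- the two squares cannot both vanish, since `v - w` and `w` are not both zero
    rcases eq_or_ne w 0 with hw | hw
    · rw [hw]
      simpa using hpos 0 t ht.1 v hv
    · exact add_pos_of_nonneg_of_pos (hnn 0 t ht.1 _) (hpos t T ht.2 w hw)
  · intro c
    refine ⟨fun t => flow A t * framedGain g G R c t * flow A (-t), ?_, fun t => ?_⟩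
    · exact ((contDiff_flow A).mul (contDiff_framedGain hgc G R c)).mul
        ((contDiff_flow A).comp contDiff_neg)
    · have e : (fun s => framedPath g h G S₀ R 0 s + c • (g s - g s * G⁻¹ * g s)) =
          framedPath g h G S₀ R c := by
        funext s
        simp [framedPath]
      have := hasDerivAt_of_framed (hder c t)
      rw [← e] at this
      exact this

lemma ContDiff.matrix_mul_const_entry {X : ℝ → Matrix (Fin n) (Fin n) ℝ} (hX : ContDiff ℝ ∞ X)
    (B : Matrix (Fin n) (Fin m) ℝ) (i : Fin n) (j : Fin m) :
    ContDiff ℝ ∞ fun t => (X t * B) i j := by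
  simp only [Matrix.mul_apply]
  exact ContDiff.sum fun k _ => (hX.matrix_entry i k).mul contDiff_const

lemma lyapunovControllableOn_of_isControllablePair {A : Matrix (Fin n) (Fin n) ℝ}
    {B : Matrix (Fin n) (Fin m) ℝ} (hAB : IsControllablePair A B) {T : ℝ} (hT : 0 < T) :
    LyapunovControllableOn A B T := by
  intro S₀ S₁ h₀ h₁
  obtain ⟨Z, C, -, -, -, -, hZ0, hZT, hC0, hCT, -, hX⟩ :=
    exists_steering_family hAB hT h₀ h₁ (Q := 0) Matrix.isSymm_zero
  obtain ⟨X, hXs, hd⟩ := hX 0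
  set S := fun s => flow A s * (Z s + (0 : ℝ) • C s) * (flow A s)ᵀ with hS
  have hUc : ∀ i j, Continuous fun t => (X t * B) i j := fun i j =>
    (hXs.matrix_mul_const_entry B i j).continuous
  have hSc : ∀ i j, Continuous fun t => S t i j := fun i j =>
    continuous_iff_continuousAt.2 fun t => ((hd t).matrix_entry i j).continuousAt
  have hb : ∀ i j, ∃ M, ∀ t ∈ Set.Icc 0 T, |(X t * B) i j| ≤ M := fun i j =>
    isCompact_Icc.exists_bound_of_continuousOn (hUc i j).continuousOn
  choose M hM using hb
  refine ⟨fun t => X t * B, S, ⟨fun i j => (hUc i j).measurable, ∑ i, ∑ j, |M i j|, ?_⟩,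
    ⟨fun i j => (hSc i j).continuousOn, ?_⟩, ?_, ?_⟩
  · intro t ht i j
    calc |(X t * B) i j| ≤ |M i j| := (hM i j t ht).trans (le_abs_self _)
      _ ≤ ∑ j, |M i j| :=
        Finset.single_le_sum (f := fun j => |M i j|) (fun _ _ => abs_nonneg _) (Finset.mem_univ j)
      _ ≤ ∑ i, ∑ j, |M i j| := Finset.single_le_sum (f := fun i => ∑ j, |M i j|)
        (fun _ _ => Finset.sum_nonneg fun _ _ => abs_nonneg _) (Finset.mem_univ i)
  · intro t _ i j
    rw [intervalIntegral.integral_eq_sub_of_hasDerivAt fun s _ => (hd s).matrix_entry i j]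
    · ring
    · refine Continuous.intervalIntegrable ?_ _ _
      change Continuous fun s => lyapunovField A B 0 (S s) (X s * B) i j
      simp only [lyapunovField, Matrix.add_apply, Matrix.mul_apply (M := A),
        Matrix.mul_apply (N := Aᵀ), Matrix.mul_apply (N := Bᵀ), Matrix.mul_apply (M := B),
        Matrix.transpose_apply]
      have := hUc
      fun_prop
  · simp [hS, hZ0, flow_zero]
  · simp only [hS, hZT, hCT, smul_zero, add_zero, flow_mul_framed_mul]

/-- The bridge, multiplied by a large constant, keeps the steering curve positive definite. -/
lemma exists_posDef_steering {A : Matrix (Fin n) (Fin n) ℝ} {B : Matrix (Fin n) (Fin m) ℝ}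
    (hAB : IsControllablePair A B) {T : ℝ} (hT : 0 < T) {S₀ S₁ Q : Matrix (Fin n) (Fin n) ℝ}
    (h₀ : S₀.PosDef) (h₁ : S₁.PosDef) (hQ : Q.IsSymm) :
    ∃ (U : ℝ → Matrix (Fin n) (Fin m) ℝ) (S : ℝ → Matrix (Fin n) (Fin n) ℝ),
      (∀ i j, ContDiff ℝ ∞ fun t => U t i j) ∧
      (∀ t i j, HasDerivAt (fun s => S s i j) (lyapunovField A B Q (S t) (U t) i j) t) ∧
      S 0 = S₀ ∧ S T = S₁ ∧ ∀ t ∈ Set.Icc 0 T, (S t).PosDef := by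
  have hherm : ∀ {M : Matrix (Fin n) (Fin n) ℝ}, M.IsHermitian ↔ M.IsSymm := fun {M} => by
    rw [Matrix.IsHermitian, Matrix.conjTranspose_eq_transpose_of_trivial, Matrix.IsSymm]
  have hinj : ∀ t, Function.Injective fun v : Fin n → ℝ => v ᵥ* flow A t := fun t =>
    Function.LeftInverse.injective (g := fun w => w ᵥ* flow A (-t)) fun v => by
      simp only [Matrix.vecMul_vecMul, flow_mul_flow_neg, Matrix.vecMul_one]
  have hconj : ∀ {M : Matrix (Fin n) (Fin n) ℝ} (t : ℝ), M.PosDef →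
      (flow A t * M * (flow A t)ᵀ).PosDef := fun t hM => by
    rw [← Matrix.conjTranspose_eq_transpose_of_trivial]
    exact hM.mul_mul_conjTranspose_same (hinj t)
  obtain ⟨Z, C, hZc, hCc, hZs, hCs, hZ0, hZT, hC0, hCT, hCpos, hX⟩ :=
    exists_steering_family hAB hT (hherm.1 h₀.isHermitian) (hherm.1 h₁.isHermitian) hQ
  have hZTpd : (Z T).PosDef := by
    have := hconj (-T) h₁
    rwa [hZT]
  have hform : ∀ {F : ℝ → Matrix (Fin n) (Fin n) ℝ}, Continuous F →
      Continuous fun x : ℝ × (Fin n → ℝ) => x.2 ⬝ᵥ (F x.1 *ᵥ x.2) := fun hF =>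
    continuous_snd.dotProduct ((hF.comp continuous_fst).matrix_mulVec continuous_snd)
  have hsplit : ∀ t ∈ Set.Icc 0 T, t = 0 ∨ t = T ∨ t ∈ Set.Ioo 0 T := fun t ht => by
    rcases ht.1.eq_or_lt with h | h
    · exact .inl h.symm
    rcases ht.2.eq_or_lt with h' | h'
    · exact .inr (.inl h')
    · exact .inr (.inr ⟨h, h'⟩)
  obtain ⟨c, hc⟩ := exists_add_mul_pos
    (isCompact_Icc.prod (isCompact_sphere (0 : Fin n → ℝ) 1) :
      IsCompact (Set.Icc (0 : ℝ) T ×ˢ Metric.sphere (0 : Fin n → ℝ) 1))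
    (hform hZc) (hform hCc)
    (fun ⟨t, v⟩ ⟨ht, hv⟩ => by
      rcases hsplit t ht with rfl | rfl | h
      · simp [hC0]
      · simp [hCT]
      · exact (hCpos t h v (ne_zero_of_mem_unit_sphere ⟨v, hv⟩)).le)
    (fun ⟨t, v⟩ ⟨ht, hv⟩ h0 => by
      have hv0 : v ≠ 0 := ne_zero_of_mem_unit_sphere ⟨v, hv⟩
      rcases hsplit t ht with rfl | rfl | h
      · simpa [hZ0] using h₀.dotProduct_mulVec_pos hv0
      · simpa using hZTpd.dotProduct_mulVec_pos hv0
      · exact absurd h0 (hCpos t h v hv0).ne')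
  have hpd : ∀ t ∈ Set.Icc 0 T, (Z t + c • C t).PosDef := fun t ht => by
    refine .of_dotProduct_mulVec_pos (hherm.2 ((hZs t).add ((hCs t).smul c))) fun v hv => ?_
    have hv' : ‖v‖ ≠ 0 := norm_ne_zero_iff.2 hv
    have h := hc (t, ‖v‖⁻¹ • v) ⟨ht, by simp [norm_smul, hv']⟩
    have e : v ⬝ᵥ ((Z t + c • C t) *ᵥ v) = ‖v‖ ^ 2 *
        ((‖v‖⁻¹ • v) ⬝ᵥ (Z t *ᵥ (‖v‖⁻¹ • v)) + c * ((‖v‖⁻¹ • v) ⬝ᵥ (C t *ᵥ (‖v‖⁻¹ • v)))) := by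
      simp only [Matrix.mulVec_smul, smul_dotProduct, dotProduct_smul, smul_eq_mul,
        Matrix.add_mulVec, Matrix.smul_mulVec, dotProduct_add]
      field_simp
    rw [star_trivial, e]
    exact mul_pos (by positivity) h
  obtain ⟨X, hXs, hd⟩ := hX c
  refine ⟨fun t => X t * B, fun s => flow A s * (Z s + c • C s) * (flow A s)ᵀ,
    hXs.matrix_mul_const_entry B, fun t => (hd t).matrix_entry, ?_, ?_,
    fun t ht => hconj t (hpd t ht)⟩
  · simp [hZ0, hC0, flow_zero]
  · simp only [hZT, hCT, smul_zero, add_zero, flow_mul_framed_mul]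

end Sufficiency

theorem theorem1 {n m : ℕ} (A : Matrix (Fin n) (Fin n) ℝ) (B : Matrix (Fin n) (Fin m) ℝ) :
    (LyapunovControllable A B ↔ IsControllablePair A B) ∧
    (∀ T : ℝ, 0 < T → (LyapunovControllableOn A B T ↔ IsControllablePair A B)) ∧
    (LyapunovControllable A B →
      ∀ T : ℝ, 0 < T →
      ∀ S₀ S₁ Q : Matrix (Fin n) (Fin n) ℝ, S₀.PosDef → S₁.PosDef → Q.PosSemidef →
        ∃ (U : ℝ → Matrix (Fin n) (Fin m) ℝ) (S : ℝ → Matrix (Fin n) (Fin n) ℝ),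
          (∀ i j, ContDiff ℝ ∞ fun t => U t i j) ∧
          (∀ t ∈ Set.Icc 0 T, ∀ i j,
            HasDerivWithinAt (fun s => S s i j) (lyapunovField A B Q (S t) (U t) i j)
              (Set.Icc 0 T) t) ∧
          S 0 = S₀ ∧ S T = S₁ ∧ ∀ t ∈ Set.Icc 0 T, (S t).PosDef) := by
  have hnec : LyapunovControllable A B → IsControllablePair A B := fun h => by
    obtain ⟨T, hT, hs⟩ := h 0 1 Matrix.isSymm_zero Matrix.isSymm_one
    exact isControllablePair_of_steers hT hs
  refine ⟨⟨hnec, fun h S₀ S₁ h₀ h₁ => ⟨1, one_pos,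
    lyapunovControllableOn_of_isControllablePair h one_pos S₀ S₁ h₀ h₁⟩⟩, fun T hT =>
    ⟨fun h => isControllablePair_of_steers hT (h 0 1 Matrix.isSymm_zero Matrix.isSymm_one),
      fun h => lyapunovControllableOn_of_isControllablePair h hT⟩, ?_⟩
  intro h T hT S₀ S₁ Q h₀ h₁ hQ
  have hQs : Q.IsSymm := by
    have := hQ.isHermitian.eq
    rwa [Matrix.conjTranspose_eq_transpose_of_trivial] at this
  obtain ⟨U, S, hU, hS, hS0, hS1, hpd⟩ := exists_posDef_steering (hnec h) hT h₀ h₁ hQs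
  exact ⟨U, S, hU, fun t _ i j => (hS t i j).hasDerivWithinAt, hS0, hS1, hpd⟩
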